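/- Let $k$ be a field, let $n>1$ be an integer not divisible by the characteristic of $k$, and let $D\in k(x)^*$ be such that $Y^n-D\in k(x)[Y]$ is irreducible. Let $K=k(x,y)$ with $y^n=D$. Write $$D=\operatorname{sgn}(D)\prod_{j\in\mathbb Z} f_j^{\,j}$$ with $\operatorname{sgn}(D)\in k^*$ and pairwise coprime, squarefree, monic polynomials $f_j\in k[x]$, almost all equal to $1$, where $f_0=1$. Put $g=\gcd(n,\ j : f_j\neq 1)$, the greatest common divisor of $n$ and of all $j\in\mathbb Z$ with $f_j\ne 1$, and for $0\le i<n$ put $$D_i=\prod_{j\in\mathbb Z} f_j^{\lfloor ij/n\rfloor}\in k(x)^*.$$ Let $k'$ be the exact constant field of $K$, i.e. the set of all elements of $K$ that are algebraic over $k$. Then $$[k':k]=\bigl|\{\,i\in\{0,\dots,n-1\} : n \text{ divides } i\,g\,\}\bigr|=g.$$ Moreover, a $k$-basis of $k'$ is given by $$\Bigl\{\,\frac{y^i}{D_i}\ :\ i\in\{0,\dots,n-1\},\ \frac ng \text{ divides } i\,\Bigr\},$$ where $y^0/D_0=1$. In particular, $k$ is the exact constant field of $K$ (that is, $k'=k$)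 if and only if $g=1$. -/

import Mathlib

open Polynomial

/-- `D = c * ∏_{j ∈ ℤ} f_j ^ j` is the squarefree decomposition of the rational function `D`, with
sign `c = sgn(D) ∈ k*`: the `f_j` are monic, squarefree and pairwise coprime polynomials, almost all
of them equal to `1`, and `f_0 = 1`. -/
structure IsSquarefreeDecomposition {k : Type*} [Field k] (D : RatFunc k) (c : k) (f : ℤ → k[X]) :
    Prop where
  sgn_ne_zero : c ≠ 0
  finite : {j : ℤ | f j ≠ 1}.Finite
  zero : f 0 = 1
  monic : ∀ j, (f j).Monic
  squarefree : ∀ j, Squarefree (f j)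
  coprime : Pairwise fun i j => IsCoprime (f i) (f j)
  eq_prod : D = RatFunc.C c * ∏ᶠ j : ℤ, (algebraMap k[X] (RatFunc k) (f j)) ^ j

/-- The number `gcd(n, j | f_j ≠ 1)`, a nonnegative integer. -/
noncomputable def exponentGcd {k : Type*} [Field k] (n : ℕ) (f : ℤ → k[X])
    (hf : {j : ℤ | f j ≠ 1}.Finite) : ℕ :=
  Nat.gcd n (hf.toFinset.gcd Int.natAbs)

/-- The rational function `D_i = ∏_{j ∈ ℤ} f_j ^ ⌊i j / n⌋`. -/
noncomputable def basisDenom {k : Type*} [Field k] (n : ℕ) (f : ℤ → k[X]) (i : ℕ) : RatFunc k :=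
  ∏ᶠ j : ℤ, (algebraMap k[X] (RatFunc k) (f j)) ^ ⌊((i : ℚ) * (j : ℚ)) / (n : ℚ)⌋

/-- The exact constant field of `K` over `k`: all elements of `K` that are algebraic over `k`. -/
noncomputable abbrev exactConstantField (k K : Type*) [Field k] [Field K] [Algebra k K] :
    IntermediateField k K :=
  algebraicClosure k K

/-! The powers of $y$ are a $k(x)$-basis of $K$. If $z=\sum a_i y^i$ is algebraic over $k$,
averaging over the embeddings $y\mapsto\zeta^s y$ isolates each $a_i y^i$, which is therefore
algebraic too (`isAlgebraic_radical_component`). If $a_i\ne 0$, then $a_i^n D^i$ is a nonzero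
constant, and valuations at the factors of the $f_j$ force $n\mid ij$ whenever $f_j\ne 1$
(`IsSquarefreeDecomposition.dvd_of_pow_mul_pow_eq_C`), that is, $n/g\mid i$. Conversely, for such
$i$ the element $y^i/D_i$ has a constant $n$-th power (`IsSquarefreeDecomposition.pow_eq`), and the
coordinate of $z$ along it is a rational function algebraic over $k$, hence constant. -/

section Decomposition

variable {k : Type*} [Field k] {f : ℤ → k[X]}

theorem mulSupport_zpow_subset (f : ℤ → k[X]) (e : ℤ → ℤ) :
    (Function.mulSupport fun j => (algebraMap k[X] (RatFunc k) (f j)) ^ e j) ⊆ {j | f j ≠ 1} := by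
  intro j hj h
  exact hj (by simp [h])

/-- A natural number `n` divides `i * gcd(n, j | f_j ≠ 1)` iff it divides all `i * j`. -/
theorem dvd_mul_exponentGcd_iff (n i : ℕ) (hf : {j : ℤ | f j ≠ 1}.Finite) :
    n ∣ i * exponentGcd n f hf ↔ ∀ j, f j ≠ 1 → (n : ℤ) ∣ i * j := by
  rw [exponentGcd, ← Nat.gcd_mul_left, Nat.dvd_gcd_iff,
    and_iff_right (Dvd.intro_left i rfl)]
  have h : i * hf.toFinset.gcd Int.natAbs = hf.toFinset.gcd fun j => i * Int.natAbs j := by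
    rw [Finset.gcd_mul_left]; simp
  rw [h, Finset.dvd_gcd_iff]
  simp only [Set.Finite.mem_toFinset, Set.mem_ofPred_eq]
  refine forall₂_congr fun j _ => ?_
  rw [← Int.natAbs_dvd_natAbs, Int.natAbs_mul, Int.natAbs_natCast, Int.natAbs_natCast]

theorem exponentGcd_dvd (n : ℕ) (hf : {j : ℤ | f j ≠ 1}.Finite) : exponentGcd n f hf ∣ n :=
  Nat.gcd_dvd_left _ _

theorem exponentGcd_pos {n : ℕ} (hn : 0 < n) (hf : {j : ℤ | f j ≠ 1}.Finite) :
    0 < exponentGcd n f hf :=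
  Nat.gcd_pos_of_pos_left _ hn

theorem div_exponentGcd_dvd_iff {n : ℕ} (hn : 0 < n) (i : ℕ) (hf : {j : ℤ | f j ≠ 1}.Finite) :
    n / exponentGcd n f hf ∣ i ↔ n ∣ i * exponentGcd n f hf := by
  rw [Nat.div_dvd_iff_dvd_mul (exponentGcd_dvd n hf) (exponentGcd_pos hn hf), mul_comm]

theorem algebraMap_ne_zero_of_monic {p : k[X]} (hp : p.Monic) :
    algebraMap k[X] (RatFunc k) p ≠ 0 :=
  RatFunc.algebraMap_ne_zero hp.ne_zero

theorem finprod_zpow_ne_zero (hf : {j : ℤ | f j ≠ 1}.Finite) (hm : ∀ j, (f j).Monic) (e : ℤ → ℤ) :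
    ∏ᶠ j : ℤ, (algebraMap k[X] (RatFunc k) (f j)) ^ e j ≠ 0 := by
  rw [finprod_eq_prod_of_mulSupport_subset_of_finite _ (mulSupport_zpow_subset f e) hf]
  exact Finset.prod_ne_zero_iff.2 fun j _ => zpow_ne_zero _ (algebraMap_ne_zero_of_monic (hm j))

theorem basisDenom_ne_zero (n i : ℕ) (hf : {j : ℤ | f j ≠ 1}.Finite) (hm : ∀ j, (f j).Monic) :
    basisDenom n f i ≠ 0 :=
  finprod_zpow_ne_zero hf hm _

theorem basisDenom_zero (n : ℕ) (f : ℤ → k[X]) : basisDenom n f 0 = 1 := by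
  simp [basisDenom]

theorem floor_mul_div_mul_self {n i : ℕ} (hn : 0 < n) {j : ℤ} (h : (n : ℤ) ∣ i * j) :
    ⌊((i : ℚ) * (j : ℚ)) / (n : ℚ)⌋ * n = j * i := by
  obtain ⟨t, ht⟩ := h
  have hq : ((i : ℚ) * (j : ℚ)) / (n : ℚ) = (t : ℤ) := by
    rw [div_eq_iff (by positivity)]
    have : (i : ℚ) * j = n * t := mod_cast ht
    rw [this, mul_comm]
  rw [hq, Int.floor_intCast, mul_comm j, ht, mul_comm]

variable {D : RatFunc k} {c : k}

/-- Divisibility makes each floor in $D_i$ exact, so the exponents match after taking $n$-th powers.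
-/
theorem IsSquarefreeDecomposition.pow_eq (hf : IsSquarefreeDecomposition D c f) {n i : ℕ}
    (hn : 0 < n) (h : ∀ j, f j ≠ 1 → (n : ℤ) ∣ i * j) :
    D ^ i = RatFunc.C (c ^ i) * basisDenom n f i ^ n := by
  have hs (e : ℤ → ℤ) := hf.finite.subset (mulSupport_zpow_subset f e)
  rw [hf.eq_prod, mul_pow, map_pow, basisDenom, finprod_pow (hs fun j => j),
    finprod_pow (hs fun j => _)]
  congr 1
  refine finprod_congr fun j => ?_
  by_cases hj : f j = 1
  · simp [hj]
  · rw [← zpow_natCast, ← zpow_natCast, ← zpow_mul, ← zpow_mul,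
      floor_mul_div_mul_self hn (h j hj)]

open IsDedekindDomain in
/-- If `a ^ n * D ^ i` is a nonzero constant, then `n` divides `i * j` whenever `f_j ≠ 1`. -/
theorem IsSquarefreeDecomposition.dvd_of_pow_mul_pow_eq_C (hf : IsSquarefreeDecomposition D c f)
    {n i : ℕ} {a : RatFunc k} {e : k} (he : e ≠ 0) (h : a ^ n * D ^ i = RatFunc.C e) {j : ℤ}
    (hj : f j ≠ 1) (hn : n ≠ 0) : (n : ℤ) ∣ i * j := by
  have hunit : ¬ IsUnit (f j) := fun hu => hj ((hf.monic j).eq_one_of_isUnit hu)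
  -- At a prime $p\mid f_j$, squarefreeness gives $f_j$ order 1 and coprimality gives the other
  -- $f_l$ order 0, so $D$ has order $j$.
  obtain ⟨p, hp, hpj⟩ := WfDvdMonoid.exists_irreducible_factor hunit (hf.monic j).ne_zero
  let v : HeightOneSpectrum k[X] :=
    ⟨Ideal.span {p}, (Ideal.span_singleton_prime hp.ne_zero).2 hp.prime, by
      simpa using hp.ne_zero⟩
  have hC {b : k} (hb : b ≠ 0) : v.valuation (RatFunc k) (RatFunc.C b) = 1 := by
    rw [← RatFunc.algebraMap_C, v.valuation_eq_one_iff_notMem, Ideal.mem_span_singleton]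
    exact fun hd => hp.not_isUnit (isUnit_of_dvd_unit hd (by simpa using hb))
  have hl {l : ℤ} (hlj : l ≠ j) : v.valuation (RatFunc k) (algebraMap k[X] _ (f l)) = 1 := by
    rw [v.valuation_eq_one_iff_notMem, Ideal.mem_span_singleton]
    exact fun hd => hp.not_isUnit ((hf.coprime hlj).isUnit_of_dvd' hd hpj)
  have hvj : v.valuation (RatFunc k) (algebraMap k[X] _ (f j)) = WithZero.exp (-1) := by
    obtain ⟨q, hq⟩ := hpj
    have hpq : ¬ p ∣ q := fun hd =>
      hp.not_isUnit (hf.squarefree j p (hq ▸ mul_dvd_mul_left p hd))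
    rw [hq, map_mul, map_mul, v.valuation_of_algebraMap, v.intValuation_singleton hp.ne_zero rfl,
      v.valuation_eq_one_iff_notMem.2 (by rwa [Ideal.mem_span_singleton]), mul_one]
  have hD : v.valuation (RatFunc k) D = WithZero.exp (-j) := by
    rw [hf.eq_prod, map_mul, hC hf.sgn_ne_zero, one_mul,
      finprod_eq_prod_of_mulSupport_subset_of_finite _ (mulSupport_zpow_subset f _) hf.finite,
      map_prod, Finset.prod_eq_single j, map_zpow₀, hvj, ← WithZero.exp_zsmul]
    · simp
    · intro l _ hlj
      rw [map_zpow₀, hl hlj, one_zpow]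
    · intro hjs
      exact absurd (hf.finite.mem_toFinset.2 hj) hjs
  have ha : v.valuation (RatFunc k) a ≠ 0 := by
    rw [Valuation.ne_zero_iff]
    rintro rfl
    rw [zero_pow hn, zero_mul] at h
    exact he (by simpa using h.symm)
  have hv := congrArg (v.valuation (RatFunc k)) h
  rw [map_mul, map_pow, map_pow, hC he, hD, ← WithZero.exp_log ha, ← WithZero.exp_nsmul,
    ← WithZero.exp_nsmul, ← WithZero.exp_add, WithZero.exp_eq_one] at hv
  -- The logarithm of the valuation is minus the order of $a$; total order zero gives
  -- $ij=-n\operatorname{ord}_p(a)$.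
  refine ⟨WithZero.log (v.valuation (RatFunc k) a), ?_⟩
  simp only [nsmul_eq_mul] at hv
  linarith

end Decomposition

/-! ### Separating the components of a radical extension -/

section Radical

variable {k F K Ω : Type*} [Field k] [Field F] [Field K] [Field Ω] [Algebra k F] [Algebra F K]
  [Algebra k K] [IsScalarTower k F K] {n : ℕ}

/-- Orthogonality of characters of $\mathbb Z/n$: off the diagonal this is a geometric sum over a
nontrivial $n$-th root of unity. -/
theorem IsPrimitiveRoot.sum_range_inv_pow_mul_pow {ζ : Ω} (hn : n ≠ 0) (hζ : IsPrimitiveRoot ζ n)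
    (i l : Fin n) :
    ∑ s ∈ Finset.range n, ζ⁻¹ ^ (s * i : ℕ) * ζ ^ (s * l : ℕ) = if l = i then (n : Ω) else 0 := by
  have hζ0 : ζ ≠ 0 := hζ.ne_zero hn
  split_ifs with hli
  · subst hli
    simp only [← mul_pow, inv_mul_cancel₀ hζ0, one_pow, Finset.sum_const, Finset.card_range,
      nsmul_eq_mul, mul_one]
  · set w := ζ⁻¹ ^ (i : ℕ) * ζ ^ (l : ℕ) with hw
    have hw1 : w ≠ 1 := by
      intro h
      apply hli
      rw [hw, inv_pow, inv_mul_eq_one₀ (pow_ne_zero _ hζ0)] at h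
      exact Fin.ext (hζ.pow_inj i.2 l.2 h).symm
    have hwn : w ^ n = 1 := by
      rw [hw, mul_pow, ← pow_mul, ← pow_mul, mul_comm (i : ℕ), mul_comm (l : ℕ), pow_mul, pow_mul,
        inv_pow, hζ.pow_eq_one]
      simp
    have hs : ∑ s ∈ Finset.range n, ζ⁻¹ ^ (s * i : ℕ) * ζ ^ (s * l : ℕ) =
        ∑ s ∈ Finset.range n, w ^ s :=
      Finset.sum_congr rfl fun s _ => by
        rw [hw, mul_pow, ← pow_mul, ← pow_mul, mul_comm s, mul_comm s]
    rw [hs, geom_sum_eq hw1, hwn, sub_self, zero_div]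

/-- Fourier inversion over the conjugates of $z$ yields $n\,a_i y^i$; all conjugates and $\zeta$ are
algebraic over $k$, and $n$ is invertible. -/
theorem isAlgebraic_radical_component_of_isPrimitiveRoot [Algebra K Ω] [Algebra F Ω] [Algebra k Ω]
    [IsScalarTower F K Ω] [IsScalarTower k K Ω] [IsScalarTower k F Ω] {ζ : Ω}
    (hchar : (n : k) ≠ 0) (pb : PowerBasis F K) {D : F}
    (hmin : minpoly F pb.gen = X ^ n - C D) (a : Fin n → F)
    (hz : IsAlgebraic k (∑ i, a i • pb.gen ^ (i : ℕ))) (i : Fin n)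
    (hζ : IsPrimitiveRoot ζ n) : IsAlgebraic k (a i • pb.gen ^ (i : ℕ)) := by
  have hn : n ≠ 0 := by rintro rfl; simp at hchar
  have hnΩ : (n : Ω) ≠ 0 := by
    have := (map_ne_zero (algebraMap k Ω)).2 hchar
    simpa using this
  have hζalg : IsAlgebraic k ζ :=
    IsAlgebraic.of_pow (Nat.pos_of_ne_zero hn) (hζ.pow_eq_one ▸ isAlgebraic_one)
  set y : Ω := algebraMap K Ω pb.gen with hy
  have hyn : y ^ n = algebraMap F Ω D := by
    have := minpoly.aeval F pb.gen
    rw [hmin] at this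
    simp only [map_sub, map_pow, aeval_X, aeval_C, sub_eq_zero] at this
    rw [hy, ← map_pow, this, ← IsScalarTower.algebraMap_apply]
  have hroot (s : ℕ) : aeval (ζ ^ s * y) (minpoly F pb.gen) = 0 := by
    simp only [hmin, map_sub, map_pow, aeval_X, aeval_C, mul_pow, hyn]
    rw [← pow_mul, mul_comm s, pow_mul, hζ.pow_eq_one]
    simp
  let z := ∑ i, a i • pb.gen ^ (i : ℕ)
  have hσ (s : ℕ) : pb.lift _ (hroot s) z = ∑ l : Fin n, ζ ^ (s * l) * (a l • y ^ (l : ℕ)) := by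
    simp only [z, map_sum, map_smul, map_pow, pb.lift_gen, mul_pow, ← pow_mul]
    exact Finset.sum_congr rfl fun l _ => (mul_smul_comm _ _ _).symm
  have hσalg (s : ℕ) : IsAlgebraic k (pb.lift _ (hroot s) z) :=
    hz.algHom ((pb.lift _ (hroot s)).restrictScalars k)
  have hsum : ∑ s ∈ Finset.range n, ζ⁻¹ ^ (s * i : ℕ) * pb.lift _ (hroot s) z =
      (n : Ω) * (a i • y ^ (i : ℕ)) := by
    simp only [hσ, Finset.mul_sum, ← mul_assoc]
    rw [Finset.sum_comm]
    simp only [← Finset.sum_mul, hζ.sum_range_inv_pow_mul_pow hn]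
    simp
  have halg : IsAlgebraic k ((n : Ω) * (a i • y ^ (i : ℕ))) := by
    rw [← hsum, ← mem_algebraicClosure_iff]
    exact sum_mem fun s _ => mul_mem (pow_mem (inv_mem (mem_algebraicClosure_iff.2 hζalg)) _)
      (mem_algebraicClosure_iff.2 (hσalg s))
  have halg' : IsAlgebraic k (a i • y ^ (i : ℕ)) := by
    have := mul_mem (inv_mem (natCast_mem (algebraicClosure k Ω) n))
      (mem_algebraicClosure_iff.2 halg)
    rwa [inv_mul_cancel_left₀ hnΩ, mem_algebraicClosure_iff] at this
  have himg : a i • y ^ (i : ℕ) = algebraMap K Ω (a i • pb.gen ^ (i : ℕ)) := by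
    rw [Algebra.smul_def, Algebra.smul_def, map_mul, map_pow,
      ← IsScalarTower.algebraMap_apply]
  rw [himg] at halg'
  exact (isAlgebraic_algebraMap_iff (algebraMap K Ω).injective).1 halg'

/-- If `z = ∑ a_i y^i` is algebraic over `k`, then so is each `a_i y^i`. Here `y` is a radical of
degree `n` invertible in `k` over a field `F` containing `k`. -/
theorem isAlgebraic_radical_component (hchar : (n : k) ≠ 0) (pb : PowerBasis F K) {D : F}
    (hmin : minpoly F pb.gen = X ^ n - C D) (a : Fin n → F)
    (hz : IsAlgebraic k (∑ i, a i • pb.gen ^ (i : ℕ))) (i : Fin n) :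
    IsAlgebraic k (a i • pb.gen ^ (i : ℕ)) := by
  have hn : (n : AlgebraicClosure K) ≠ 0 := by
    have := (map_ne_zero (algebraMap k (AlgebraicClosure K))).2 hchar
    simpa using this
  have : NeZero (n : AlgebraicClosure K) := ⟨hn⟩
  obtain ⟨ζ, hζ⟩ := HasEnoughRootsOfUnity.exists_primitiveRoot (AlgebraicClosure K) n
  exact isAlgebraic_radical_component_of_isPrimitiveRoot hchar pb hmin a hz i hζ

end Radical

/-! ### Basis and degree of the constant field -/

/-- A rational function that becomes algebraic over the constants is constant. -/
theorem exists_eq_C_of_isAlgebraic_algebraMap {k K : Type*} [Field k] [Field K]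
    [Algebra (RatFunc k) K] [Algebra k K] [IsScalarTower k (RatFunc k) K] {a : RatFunc k}
    (h : IsAlgebraic k (algebraMap (RatFunc k) K a)) : ∃ e, a = RatFunc.C e := by
  by_contra hne
  exact RatFunc.transcendental_of_ne_C a hne
    ((isAlgebraic_algebraMap_iff (algebraMap (RatFunc k) K).injective).1 h)

/-- There are `g` multiples of `n / g` below `n`. -/
theorem card_filter_range_dvd {n g : ℕ} (hn : 0 < n) (hg : g ∣ n) :
    ((Finset.range n).filter fun i => n / g ∣ i).card = g := by
  obtain ⟨m, rfl⟩ := hg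
  have hg0 : 0 < g := Nat.pos_of_mul_pos_right hn
  have hm0 : 0 < m := Nat.pos_of_mul_pos_left hn
  rw [Nat.mul_div_cancel_left m hg0]
  have : (Finset.range (g * m)).filter (fun i => m ∣ i) = (Finset.range g).image (m * ·) := by
    ext i
    simp only [Finset.mem_filter, Finset.mem_range, Finset.mem_image]
    constructor
    · rintro ⟨hi, t, rfl⟩
      exact ⟨t, by rw [mul_comm g] at hi; exact lt_of_mul_lt_mul_left hi hm0.le, rfl⟩
    · rintro ⟨t, ht, rfl⟩
      exact ⟨by rw [mul_comm g]; exact Nat.mul_lt_mul_of_pos_left ht hm0, dvd_mul_right _ _⟩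
  rw [this, Finset.card_image_of_injective _ (fun _ _ h => Nat.eq_of_mul_eq_mul_left hm0 h), Finset.card_range]

/-- The constants `y^i / D_i`, for `n ∣ i * gcd(n, j | f_j ≠ 1)`, form a basis of the exact constant
field. -/
theorem exists_basis_exactConstantField {k K : Type*} [Field k] [Field K] [Algebra (RatFunc k) K]
    [Algebra k K] [IsScalarTower k (RatFunc k) K] {n : ℕ} (hchar : (n : k) ≠ 0)
    {D : RatFunc k} (hirr : Irreducible (X ^ n - C D : (RatFunc k)[X]))
    {y : K} (hy : y ^ n = algebraMap (RatFunc k) K D)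
    (hK : IntermediateField.adjoin (RatFunc k) {y} = ⊤)
    {c : k} {f : ℤ → k[X]} (hf : IsSquarefreeDecomposition D c f) :
    ∃ b : Module.Basis {i : Fin n // n / exponentGcd n f hf.finite ∣ (i : ℕ)} k
        (exactConstantField k K),
      ∀ i, (b i : K) =
        y ^ ((i : Fin n) : ℕ) / algebraMap (RatFunc k) K (basisDenom n f ((i : Fin n) : ℕ)) := by
  have hn : n ≠ 0 := by rintro rfl; simp at hchar
  have hnpos := Nat.pos_of_ne_zero hn
  have hmonic : (X ^ n - C D).Monic := monic_X_pow_sub_C D hn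
  have hroot : aeval y (X ^ n - C D) = 0 := by simp [hy]
  have hmin : minpoly (RatFunc k) y = X ^ n - C D :=
    (minpoly.eq_of_irreducible_of_monic hirr hroot hmonic).symm
  have hint : IsIntegral (RatFunc k) y := ⟨_, hmonic, hroot⟩
  have htop : Algebra.adjoin (RatFunc k) {y} = ⊤ := by
    rw [← IntermediateField.adjoin_simple_toSubalgebra_of_isAlgebraic hint.isAlgebraic, hK,
      IntermediateField.top_toSubalgebra]
  let pb : PowerBasis (RatFunc k) K := PowerBasis.ofAdjoinEqTop hint htop
  have hgen : pb.gen = y := PowerBasis.ofAdjoinEqTop_gen hint htop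
  have hdim : pb.dim = n := by
    rw [PowerBasis.ofAdjoinEqTop_dim, hmin, natDegree_X_pow_sub_C]
  let B : Module.Basis (Fin n) (RatFunc k) K := pb.basis.reindex (finCongr hdim)
  have hB (i : Fin n) : B i = y ^ (i : ℕ) := by
    simp [B, hgen]
  have hD : D ≠ 0 := by
    rw [hf.eq_prod]
    exact mul_ne_zero (by simpa using hf.sgn_ne_zero) (finprod_zpow_ne_zero hf.finite hf.monic _)
  have hden (i : ℕ) : basisDenom n f i ≠ 0 := basisDenom_ne_zero n i hf.finite hf.monic
  -- Rescaling $y^i$ by $D_i^{-1}$ makes the coordinates of algebraic elements constants.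
  let B' : Module.Basis (Fin n) (RatFunc k) K :=
    B.isUnitSMul (w := fun i => (basisDenom n f i)⁻¹) fun i => (inv_ne_zero (hden i)).isUnit
  have hB'B (i : Fin n) : B' i = (basisDenom n f i)⁻¹ • B i :=
    Module.Basis.isUnitSMul_apply _ _
  have hB' (i : Fin n) : B' i = y ^ (i : ℕ) / algebraMap (RatFunc k) K (basisDenom n f i) := by
    rw [hB'B, hB, Algebra.smul_def, map_inv₀, div_eq_inv_mul]
  have hdvd (i : ℕ) : n / exponentGcd n f hf.finite ∣ i ↔ ∀ j, f j ≠ 1 → (n : ℤ) ∣ i * j := by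
    rw [div_exponentGcd_dvd_iff hnpos, dvd_mul_exponentGcd_iff]
  have hmap (e : k) : algebraMap (RatFunc k) K (RatFunc.C e) = algebraMap k K e := by
    rw [IsScalarTower.algebraMap_apply k (RatFunc k) K, RatFunc.algebraMap_eq_C]
  have hB'alg (i : Fin n) (hi : n / exponentGcd n f hf.finite ∣ i) : IsAlgebraic k (B' i) := by
    refine IsAlgebraic.of_pow hnpos ?_
    have : B' i ^ n = algebraMap k K (c ^ (i : ℕ)) := by
      rw [hB', div_pow, ← pow_mul, mul_comm, pow_mul, hy, ← map_pow, ← map_pow,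
        hf.pow_eq hnpos ((hdvd i).1 hi), map_mul, hmap,
        mul_div_cancel_right₀ _ ((_root_.map_ne_zero _).2 (pow_ne_zero _ (hden i)))]
    rw [this]
    exact isAlgebraic_algebraMap _
  let w : {i : Fin n // n / exponentGcd n f hf.finite ∣ (i : ℕ)} → exactConstantField k K :=
    fun i => ⟨B' i, mem_algebraicClosure_iff.2 (hB'alg i i.2)⟩
  have hw : LinearIndependent k w := by
    refine LinearIndependent.of_comp (exactConstantField k K).val.toLinearMap ?_
    exact (B'.linearIndependent.restrict_scalars' k).comp _ Subtype.val_injective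
  have hspan : ⊤ ≤ Submodule.span k (Set.range w) := by
    rintro ⟨z, hz⟩ -
    have hzalg := mem_algebraicClosure_iff.1 hz
    have hcomp (i : Fin n) : IsAlgebraic k (B'.repr z i • B' i) := by
      have hsum : z = ∑ l : Fin n, (B'.repr z l * (basisDenom n f l)⁻¹) • pb.gen ^ (l : ℕ) := by
        conv_lhs => rw [← B'.sum_repr z]
        refine Finset.sum_congr rfl fun l _ => ?_
        rw [hB'B, hB, hgen, mul_smul]
      have := isAlgebraic_radical_component hchar pb (by rw [hgen, hmin]) _ (hsum ▸ hzalg) i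
      rwa [hgen, mul_smul, ← hB, ← hB'B] at this
    have hB0 (i : Fin n) : B' i ≠ 0 := B'.ne_zero i
    have hzero (i : Fin n) (hi : ¬ n / exponentGcd n f hf.finite ∣ i) : B'.repr z i = 0 := by
      by_contra ha
      set a := B'.repr z i * (basisDenom n f i)⁻¹ with ha'
      have ha0 : a ≠ 0 := mul_ne_zero ha (inv_ne_zero (hden i))
      have hpow : (B'.repr z i • B' i) ^ n = algebraMap (RatFunc k) K (a ^ n * D ^ (i : ℕ)) := by
        rw [hB'B, hB, ← mul_smul, ← ha', Algebra.smul_def, mul_pow,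
          ← pow_mul, mul_comm (i : ℕ), pow_mul, hy, map_mul (algebraMap (RatFunc k) K) (a ^ n),
          map_pow, map_pow]
      obtain ⟨e, he⟩ := exists_eq_C_of_isAlgebraic_algebraMap (K := K)
        (hpow ▸ (hcomp i).pow n)
      have he0 : e ≠ 0 := by
        rintro rfl
        rw [map_zero] at he
        exact mul_ne_zero (pow_ne_zero _ ha0) (pow_ne_zero _ hD) he
      exact hi ((hdvd i).2 fun j hj => hf.dvd_of_pow_mul_pow_eq_C he0 he hj hn)
    have hconst (i : Fin n) (hi : n / exponentGcd n f hf.finite ∣ i) :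
        ∃ e, B'.repr z i = RatFunc.C e := by
      refine exists_eq_C_of_isAlgebraic_algebraMap (K := K) ?_
      -- The coordinate is a quotient of two algebraic elements, the component of $z$ and the basis
      -- vector.
      have := div_mem (mem_algebraicClosure_iff.2 (hcomp i))
        (mem_algebraicClosure_iff.2 (hB'alg i hi))
      rwa [Algebra.smul_def, mul_div_cancel_right₀ _ (hB0 i), mem_algebraicClosure_iff] at this
    have hmem : z ∈ (Submodule.span k (Set.range w)).map
        (exactConstantField k K).val.toLinearMap := by
      rw [← B'.sum_repr z]
      refine sum_mem fun i _ => ?_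
      by_cases hi : n / exponentGcd n f hf.finite ∣ (i : ℕ)
      · obtain ⟨e, he⟩ := hconst i hi
        rw [he, Algebra.smul_def, hmap, ← Algebra.smul_def]
        exact Submodule.smul_mem _ _ ⟨w ⟨i, hi⟩, Submodule.subset_span ⟨_, rfl⟩, rfl⟩
      · rw [hzero i hi, zero_smul]
        exact zero_mem _
    obtain ⟨x, hx, hxz⟩ := hmem
    have : (⟨z, hz⟩ : exactConstantField k K) = x := Subtype.ext hxz.symm
    exact this ▸ hx
  exact ⟨Module.Basis.mk hw hspan, fun i => by rw [Module.Basis.mk_apply, ← hB']⟩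

theorem mainTheorem2 {k K : Type*} [Field k] [Field K] [Algebra (RatFunc k) K] [Algebra k K]
    [IsScalarTower k (RatFunc k) K] (n : ℕ) (hn : 1 < n) (hchar : (n : k) ≠ 0)
    (D : RatFunc k) (hirr : Irreducible (X ^ n - C D : (RatFunc k)[X]))
    (y : K) (hy : y ^ n = algebraMap (RatFunc k) K D)
    (hK : IntermediateField.adjoin (RatFunc k) {y} = ⊤)
    (c : k) (f : ℤ → k[X]) (hf : IsSquarefreeDecomposition D c f) :
    -- the degree of the exact constant field, in both forms
    Module.finrank k (exactConstantField k K) =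
        ((Finset.range n).filter fun i => n ∣ i * exponentGcd n f hf.finite).card ∧
      Module.finrank k (exactConstantField k K) = exponentGcd n f hf.finite ∧
      -- the explicit basis, indexed by the `i < n` divisible by `n / gcd(n, j | f_j ≠ 1)`
      (∃ b : Module.Basis {i : Fin n // n / exponentGcd n f hf.finite ∣ (i : ℕ)} k
          (exactConstantField k K),
        ∀ i, (b i : K) =
          y ^ ((i : Fin n) : ℕ) / algebraMap (RatFunc k) K (basisDenom n f ((i : Fin n) : ℕ))) ∧
      y ^ 0 / algebraMap (RatFunc k) K (basisDenom n f 0) = 1 ∧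
      -- the criterion for `k` to be the exact constant field
      (exactConstantField k K = ⊥ ↔ exponentGcd n f hf.finite = 1) := by
  have hnpos : 0 < n := by lia
  obtain ⟨b, hb⟩ := exists_basis_exactConstantField hchar hirr hy hK hf
  have hcard : Module.finrank k (exactConstantField k K) = exponentGcd n f hf.finite := by
    rw [Module.finrank_eq_card_basis b, Fintype.card_subtype, Finset.card_filter,
      Fin.sum_univ_eq_sum_range (fun i => if n / exponentGcd n f hf.finite ∣ i then 1 else 0) n,
      ← Finset.card_filter]
    exact card_filter_range_dvd hnpos (exponentGcd_dvd n hf.finite)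
  refine ⟨?_, hcard, ⟨b, hb⟩, ?_, ?_⟩
  · rw [hcard]
    simp only [← div_exponentGcd_dvd_iff hnpos]
    exact (card_filter_range_dvd hnpos (exponentGcd_dvd n hf.finite)).symm
  · simp [basisDenom_zero]
  · rw [← hcard, IntermediateField.finrank_eq_one_iff]
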